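/- **Setting.** Let $\mathcal X$ be a non-empty Polish space with its Borel $\sigma$-algebra, and let $\mathcal G$ be a compact, second countable, Hausdorff topological group, with its Borel $\sigma$-algebra and normalised Haar measure $\lambda$, acting on $\mathcal X$ by a measurable action $\mathcal G\times\mathcal X\to\mathcal X$. Let $\mu$ be a $\mathcal G$-invariant Borel probability measure on $\mathcal X$ with $\operatorname{supp}\mu=\mathcal X$; write $\|h\|_\mu^2=\int_{\mathcal X} h^2\,d\mu$. Let $\mathcal H$ be a reproducing kernel Hilbert space of functions $\mathcal X\to\mathbb R$ whose kernel $k:\mathcal X\times\mathcal X\to\mathbb R$ is measurable, with $k(\cdot,x)$ continuous for every $x$ and $\sup_{x}k(x,x)=M_k<\infty$. Write $\iota:\mathcal H\to L_2(\mu)$ for the inclusion, $\mathcal O f(x)=\int_{\mathcal G}f(gx)\,d\lambda(g)$ for the averaging operator on $L_2(\mu)$, and $$k^\perp(x,y)=k(x,y)-\int_{\mathcal G}k(x,gy)\,d\lambda(g),\qquad \|k^\perp\|_{L_2(\mu\otimes\mu)}^2=\int_{\mathcal X}\int_{\mathcal X}k^\perp(x,y)^2\,d\mu(x)\,d\mu(y).$$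 **Theorem.** Let $n\ge 1$ and let $((X_i,Y_i):i=1,\dots,n)$ be i.i.d. with $X_i\sim\mu$ and $Y_i=f^\star(X_i)+\xi_i$, where $f^\star\in L_2(\mu)$ is $\mathcal G$-invariant, $\mathbb E[\xi_i\mid X_1,\dots,X_n]=0$ and $\mathbb E[\xi_i\xi_j\mid X_1,\dots,X_n]=\sigma^2\delta_{ij}<\infty$ for $i,j=1,\dots,n$. Similarly let $X\sim\mu$ and $Y=f^\star(X)+\xi$ with $\mathbb E[\xi\mid X]=0$ and $\mathbb E[\xi^2]=\sigma^2<\infty$. For a predictor $h\in L_2(\mu)$ let $R[h]=\mathbb E[(h(X)-Y)^2]$; for a random predictor, such as one that depends on the training sample, $R$ is evaluated at each realisation of the predictor, the expectation being over the test pair $(X,Y)$ only. Let $\rho>0$, let $f$ be the solution of the kernel ridge regression problem $$\operatorname*{argmin}_{h\in\mathcal H}\ \sum_{i=1}^n(h(X_i)-Y_i)^2+\rho\|h\|_{\mathcal H}^2,$$ and let $\bar f=\mathcal O\iota f$. Let $f'\in L_2(\mu)$ be any predictor (possibly random, with $R[f']$ measurable) with risk not larger than that of $\bar f$, i.e. $R[f']\le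 R[\bar f]$ almost surely. Then the random variables $R[f]$, $R[f']$ and $\|(\mathrm{id}-\mathcal O)\iota\Lambda f^\star\|_\mu^2$ are integrable and $$\mathbb E\big[R[f]-R[f']\big]\ \ge\ \mathbb E\big[\|(\mathrm{id}-\mathcal O)\,\iota\,\Lambda f^\star\|_\mu^2\big]+\sigma^2\,\frac{\|k^\perp\|^2_{L_2(\mu\otimes\mu)}}{\big(\sqrt n\,M_k+\rho/\sqrt n\big)^2},$$ where $\Lambda f^\star$ is the solution of the corresponding noiseless problem $$\operatorname*{argmin}_{h\in\mathcal H}\ \sum_{i=1}^n(h(X_i)-f^\star(X_i))^2+\rho\|h\|_{\mathcal H}^2 .$$ -/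

import Mathlib

open MeasureTheory ProbabilityTheory

/-- The real-valued reproducing kernel `k(x, y) = ⟪k_x, k_y⟫` of a reproducing kernel Hilbert
space `H` of real functions on `𝒳`. Mathlib's kernel is operator-valued; an operator on `ℝ` is
identified with its value at `1`. -/
noncomputable def rkhsKernel {𝒳 : Type*} (H : Type*) [NormedAddCommGroup H]
    [InnerProductSpace ℝ H] [CompleteSpace H] [RKHS ℝ H 𝒳 ℝ] (x y : 𝒳) : ℝ :=
  RKHS.kernel H x y 1

/-- The orbit averaging operator `(O f)(x) = ∫_G f(g x) dlam(g)`. -/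
noncomputable def orbitAverage {G 𝒳 : Type*} [MeasurableSpace G] [SMul G 𝒳] (lam : Measure G)
    (f : 𝒳 → ℝ) (x : 𝒳) : ℝ :=
  ∫ g, f (g • x) ∂lam

/-- The part of the kernel `k` that is removed by averaging over its second argument:
`k^⊥(x, y) = k(x, y) - ∫_G k(x, g y) dlam(g)`. -/
noncomputable def kernelPerp {G 𝒳 : Type*} [MeasurableSpace G] [SMul G 𝒳] (lam : Measure G)
    (k : 𝒳 → 𝒳 → ℝ) (x y : 𝒳) : ℝ :=
  k x y - orbitAverage lam (k x) y

/-- The squared norm `‖h‖²` of `h` in `L₂(μ)`. -/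
noncomputable def sqNormL2 {S : Type*} [MeasurableSpace S] (μ : Measure S) (h : S → ℝ) : ℝ :=
  ∫ s, h s ^ 2 ∂μ

/-- The objective of kernel ridge regression on the data `(x₁, y₁), …, (xₙ, yₙ)` with
regularisation parameter `ρ`: `∑ᵢ (f(xᵢ) - yᵢ)² + ρ ‖f‖²_H`. -/
noncomputable def krrObjective {𝒳 H : Type*} [NormedAddCommGroup H] [InnerProductSpace ℝ H]
    [RKHS ℝ H 𝒳 ℝ] {n : ℕ} (ρ : ℝ) (x : Fin n → 𝒳) (y : Fin n → ℝ) (f : H) : ℝ :=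
  ∑ i, (f (x i) - y i) ^ 2 + ρ * ‖f‖ ^ 2

/-- `f` solves the kernel ridge regression problem: it minimises the objective over all of `H`. -/
def IsKRRSolution {𝒳 H : Type*} [NormedAddCommGroup H] [InnerProductSpace ℝ H]
    [RKHS ℝ H 𝒳 ℝ] {n : ℕ} (ρ : ℝ) (x : Fin n → 𝒳) (y : Fin n → ℝ) (f : H) : Prop :=
  ∀ h : H, krrObjective ρ x y f ≤ krrObjective ρ x y h

/-- The risk `R[h] = E[(h(X) - Y)²]` of a (non-random) predictor `h` with respect to a test
pair `(X, Y)`. For a random predictor it is evaluated at each realisation of the predictor, so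
that the expectation is over the test pair alone. -/
noncomputable def risk {Ω 𝒳 : Type*} [MeasurableSpace Ω] (P : Measure Ω) (X : Ω → 𝒳) (Y : Ω → ℝ)
    (h : 𝒳 → ℝ) : ℝ :=
  ∫ ω, (h (X ω) - Y ω) ^ 2 ∂P

/-! By the representer theorem the ridge predictor is a linear smoother, `f z = ∑ l, Y l * a l z`.
Its weights `a l` are built from `(K + ρ)⁻¹` and depend on the inputs only. As `μ` and `fstar` are
invariant, averaging is an orthogonal projection fixing `fstar`, so Pythagoras gives `R[f] - R[O f]
= ‖f - O f‖²`, which bounds `R[f] - R[f']` from below (`integral_sub_sq_eq_orbitAverage_add`).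

Now `f - O f = ∑ l, Y l * b l` with `b l = a l - O (a l)`. Given the inputs, the noise is centred
with covariance `σ² I`, so cross terms vanish in expectation: what remains is the noiseless term
plus `σ² ∑ l, E ‖b l‖²` (`integral_sqNormL2_smoother_add_noise`).

Finally, pointwise in `z`, the vector `(b l z)` is `(K + ρ)⁻¹` applied to `(k^⊥(X i, z))`. Since `K
+ ρ` has operator norm at most `n M + ρ`, inverting it shrinks a vector by at most that factor
(`sq_le_inv_mulVec_of_coercive`). Integration turns this into the kernel term
(`sqNormL2_kernelPerp_div_le`). -/

section

open scoped Matrix RealInnerProductSpace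

/-! ### Inverses of coercive matrices -/

section Coercive

variable {n : ℕ} {B : Matrix (Fin n) (Fin n) ℝ} {ρ : ℝ}

lemma isUnit_det_of_coercive (hρ : 0 < ρ)
    (hB : ∀ v : Fin n → ℝ, ρ * (v ⬝ᵥ v) ≤ v ⬝ᵥ (B *ᵥ v)) : IsUnit B.det := by
  rw [isUnit_iff_ne_zero]
  intro h0
  obtain ⟨v, hv, h⟩ := Matrix.exists_mulVec_eq_zero_iff.2 h0
  have h1 := hB v
  rw [h, dotProduct_zero] at h1
  have h2 : v ⬝ᵥ v = 0 :=
    le_antisymm (by nlinarith) (Finset.sum_nonneg fun _ _ => mul_self_nonneg _)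
  exact hv (dotProduct_self_eq_zero.1 h2)

lemma dotProduct_sq_le (v w : Fin n → ℝ) : (v ⬝ᵥ w) ^ 2 ≤ (v ⬝ᵥ v) * (w ⬝ᵥ w) := by
  have := Finset.sum_mul_sq_le_sq_mul_sq Finset.univ v w
  simpa [dotProduct, pow_two] using this

lemma dotProduct_self_nonneg_real (v : Fin n → ℝ) : 0 ≤ v ⬝ᵥ v :=
  Finset.sum_nonneg fun _ _ => mul_self_nonneg _

/-- Coercivity at `w = B⁻¹ v` reads `ρ |w|² ≤ w ⬝ v`; Cauchy–Schwarz bounds the right side by `|w|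
|v|`. -/
lemma inv_mulVec_sq_le_of_coercive (hρ : 0 < ρ)
    (hB : ∀ v : Fin n → ℝ, ρ * (v ⬝ᵥ v) ≤ v ⬝ᵥ (B *ᵥ v)) (v : Fin n → ℝ) :
    ρ ^ 2 * ((B⁻¹ *ᵥ v) ⬝ᵥ (B⁻¹ *ᵥ v)) ≤ v ⬝ᵥ v := by
  have h1 := hB (B⁻¹ *ᵥ v)
  rw [Matrix.mulVec_mulVec, Matrix.mul_nonsing_inv _ (isUnit_det_of_coercive hρ hB),
    Matrix.one_mulVec] at h1
  have h2 := dotProduct_sq_le (B⁻¹ *ᵥ v) v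
  set W := (B⁻¹ *ᵥ v) ⬝ᵥ (B⁻¹ *ᵥ v)
  have hW : 0 ≤ W := dotProduct_self_nonneg_real _
  have hV : 0 ≤ v ⬝ᵥ v := dotProduct_self_nonneg_real _
  rcases hW.eq_or_lt with h | h
  · rw [← h]; simpa using hV
  · have h3 : (ρ * W) ^ 2 ≤ W * (v ⬝ᵥ v) := (pow_le_pow_left₀ (by positivity) h1 2).trans h2
    refine le_of_mul_le_mul_left ?_ h
    linarith

/-- Column `j` of `B⁻¹` is the image of a unit vector. This bound makes the ridge weights bounded,
on which all later integrability rests. -/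
lemma abs_inv_apply_le_of_coercive (hρ : 0 < ρ)
    (hB : ∀ v : Fin n → ℝ, ρ * (v ⬝ᵥ v) ≤ v ⬝ᵥ (B *ᵥ v)) (i j : Fin n) :
    |B⁻¹ i j| ≤ 1 / ρ := by
  have h := inv_mulVec_sq_le_of_coercive hρ hB (Pi.single j 1)
  have h1 : (B⁻¹ i j) ^ 2 ≤ (B⁻¹ *ᵥ Pi.single j 1) ⬝ᵥ (B⁻¹ *ᵥ Pi.single j 1) := by
    have := Finset.single_le_sum (f := fun i => B⁻¹ i j * B⁻¹ i j)
      (fun i _ => mul_self_nonneg _) (Finset.mem_univ i)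
    simpa [dotProduct, pow_two] using this
  have h2 : (ρ * B⁻¹ i j) ^ 2 ≤ 1 := by
    have : (Pi.single j 1 : Fin n → ℝ) ⬝ᵥ Pi.single j 1 = 1 := by simp
    rw [this] at h
    nlinarith
  have h3 := (sq_le_one_iff_abs_le_one _).1 h2
  rw [abs_mul, abs_of_pos hρ] at h3
  rw [le_div_iff₀ hρ]
  linarith

/-- With `w = B⁻¹ v` one has `v = K w + ρ w`, and the entrywise bound on `K` gives `|K w| ≤ n M
|w|`, row by row through Cauchy–Schwarz. Coercivity serves only to invert `B`. -/
lemma sq_le_inv_mulVec_of_coercive {K : Matrix (Fin n) (Fin n) ℝ} {M : ℝ} (hρ : 0 < ρ)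
    (hB : ∀ v : Fin n → ℝ, ρ * (v ⬝ᵥ v) ≤ v ⬝ᵥ (B *ᵥ v)) (hM : 0 ≤ M)
    (hK : ∀ i j, |K i j| ≤ M) (hBK : B = K + ρ • 1) (v : Fin n → ℝ) :
    v ⬝ᵥ v ≤ (n * M + ρ) ^ 2 * ((B⁻¹ *ᵥ v) ⬝ᵥ (B⁻¹ *ᵥ v)) := by
  set w := B⁻¹ *ᵥ v with hw
  have hv : v = K *ᵥ w + ρ • w := by
    have : B *ᵥ w = v := by
      rw [hw, Matrix.mulVec_mulVec, Matrix.mul_nonsing_inv _ (isUnit_det_of_coercive hρ hB),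
        Matrix.one_mulVec]
    rw [← this, hBK, Matrix.add_mulVec, Matrix.smul_mulVec, Matrix.one_mulVec]
  have hW : 0 ≤ w ⬝ᵥ w := dotProduct_self_nonneg_real _
  have hKw : (K *ᵥ w) ⬝ᵥ (K *ᵥ w) ≤ (n * M) ^ 2 * (w ⬝ᵥ w) := by
    have h1 : ∀ i, (K *ᵥ w) i * (K *ᵥ w) i ≤ n * M ^ 2 * (w ⬝ᵥ w) := fun i => by
      have h2 := dotProduct_sq_le (K i) w
      have h3 : K i ⬝ᵥ K i ≤ n * M ^ 2 := by
        calc K i ⬝ᵥ K i ≤ ∑ _j : Fin n, M ^ 2 := Finset.sum_le_sum fun j _ => by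
              rw [← pow_two, ← sq_abs]; exact pow_le_pow_left₀ (abs_nonneg _) (hK i j) 2
          _ = n * M ^ 2 := by simp
      calc (K *ᵥ w) i * (K *ᵥ w) i = (K i ⬝ᵥ w) ^ 2 := by rw [pow_two]; rfl
        _ ≤ _ := h2.trans (mul_le_mul_of_nonneg_right h3 hW)
    calc (K *ᵥ w) ⬝ᵥ (K *ᵥ w) ≤ ∑ _i : Fin n, n * M ^ 2 * (w ⬝ᵥ w) :=
          Finset.sum_le_sum fun i _ => h1 i
      _ = _ := by simp; ring
  have hwK : w ⬝ᵥ (K *ᵥ w) ≤ n * M * (w ⬝ᵥ w) := by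
    refine le_of_abs_le (abs_le_of_sq_le_sq ?_ (by positivity))
    calc _ ≤ _ := dotProduct_sq_le _ _
      _ ≤ (w ⬝ᵥ w) * ((n * M) ^ 2 * (w ⬝ᵥ w)) := mul_le_mul_of_nonneg_left hKw hW
      _ = _ := by ring
  have he : v ⬝ᵥ v = (K *ᵥ w) ⬝ᵥ (K *ᵥ w) + 2 * ρ * (w ⬝ᵥ (K *ᵥ w)) + ρ ^ 2 * (w ⬝ᵥ w) := by
    rw [hv]
    simp only [add_dotProduct, dotProduct_add, smul_dotProduct, dotProduct_smul, smul_eq_mul,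
      dotProduct_comm (K *ᵥ w) w]
    ring
  rw [he]
  nlinarith

end Coercive

/-- The regularised Gram matrix `K + ρ` of a kernel at given points. -/
noncomputable def ridgeMatrix {𝒳 : Type*} {n : ℕ} (k : 𝒳 → 𝒳 → ℝ) (ρ : ℝ) (x : Fin n → 𝒳) :
    Matrix (Fin n) (Fin n) ℝ :=
  Matrix.of (fun i j => k (x i) (x j)) + ρ • 1

/-! ### Ridge regression in the Hilbert space -/

section RKHS

variable {𝒳 H : Type*} [NormedAddCommGroup H] [InnerProductSpace ℝ H] [RKHS ℝ H 𝒳 ℝ]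

/-- First-order optimality of a minimiser of the ridge regression objective. -/
lemma IsKRRSolution.stationary {n : ℕ} {ρ : ℝ} {x : Fin n → 𝒳} {y : Fin n → ℝ} {f : H}
    (hf : IsKRRSolution ρ x y f) (u : H) :
    ∑ i, (f (x i) - y i) * u (x i) + ρ * ⟪f, u⟫ = 0 := by
  set a := ∑ i, (f (x i) - y i) * u (x i) + ρ * ⟪f, u⟫ with ha
  set b := ∑ i, u (x i) ^ 2 + ρ * ‖u‖ ^ 2 with hb
  -- Along the line `f + t • u` the objective is a quadratic in `t` minimal at `0`. Its increment
  -- has no constant term, so a nonpositive discriminant forces the linear coefficient to vanish.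
  have key : ∀ t : ℝ, 0 ≤ b * (t * t) + 2 * a * t + 0 := fun t => by
    have h := hf (f + t • u)
    have e : krrObjective ρ x y (f + t • u) = krrObjective ρ x y f + 2 * a * t + b * (t * t) := by
      have h1 : ‖f + t • u‖ ^ 2 = ‖f‖ ^ 2 + 2 * (t * ⟪f, u⟫) + t * t * ‖u‖ ^ 2 := by
        rw [norm_add_sq_real, inner_smul_right, norm_smul, mul_pow, Real.norm_eq_abs, sq_abs]
        ring
      have h2 : ∑ i, ((f + t • u) (x i) - y i) ^ 2 = ∑ i, (f (x i) - y i) ^ 2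
          + 2 * t * ∑ i, (f (x i) - y i) * u (x i) + t * t * ∑ i, u (x i) ^ 2 := by
        rw [Finset.mul_sum, Finset.mul_sum, ← Finset.sum_add_distrib, ← Finset.sum_add_distrib]
        refine Finset.sum_congr rfl fun i _ => ?_
        rw [RKHS.coe_add, RKHS.coe_smul]
        simp only [Pi.add_apply, Pi.smul_apply, smul_eq_mul]
        ring
      rw [krrObjective, krrObjective, h1, h2, ha, hb]
      ring
    linarith
  have hd := discrim_le_zero key
  rw [discrim] at hd
  have : a ^ 2 ≤ 0 := by nlinarith
  exact pow_eq_zero_iff (two_ne_zero) |>.1 (le_antisymm this (sq_nonneg a))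

variable [CompleteSpace H]

lemma rkhs_apply_eq_inner (h : H) (x : 𝒳) : h x = ⟪h, RKHS.kerFun H x (1 : ℝ)⟫ := by
  rw [RKHS.inner_kerFun]; simp

lemma rkhsKernel_eq_inner (x y : 𝒳) :
    rkhsKernel H x y = ⟪RKHS.kerFun H x (1 : ℝ), RKHS.kerFun H y (1 : ℝ)⟫ := by
  rw [real_inner_comm, ← RKHS.kernel_inner]
  simp [rkhsKernel]

lemma rkhsKernel_comm (x y : 𝒳) : rkhsKernel H x y = rkhsKernel H y x := by
  rw [rkhsKernel_eq_inner, real_inner_comm, ← rkhsKernel_eq_inner]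

lemma rkhsKernel_self_nonneg (x : 𝒳) : 0 ≤ rkhsKernel H x x := by
  rw [rkhsKernel_eq_inner]; exact real_inner_self_nonneg

lemma abs_rkhsKernel_le {M : ℝ} (hM : ∀ x : 𝒳, rkhsKernel H x x ≤ M) (x y : 𝒳) :
    |rkhsKernel H x y| ≤ M := by
  have h := fun x : 𝒳 => hM x
  simp only [rkhsKernel_eq_inner, real_inner_self_eq_norm_sq] at h
  rw [rkhsKernel_eq_inner]
  refine (abs_real_inner_le_norm _ _).trans ?_
  nlinarith [h x, h y, sq_nonneg (‖RKHS.kerFun H x (1 : ℝ)‖ - ‖RKHS.kerFun H y (1 : ℝ)‖)]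

/-- The Gram matrix is positive semidefinite: its quadratic form is the squared norm of `∑ i, v i •
k_{x i}`. -/
lemma ridgeMatrix_coercive {n : ℕ} (ρ : ℝ) (x : Fin n → 𝒳) (v : Fin n → ℝ) :
    ρ * (v ⬝ᵥ v) ≤ v ⬝ᵥ (ridgeMatrix (rkhsKernel H) ρ x *ᵥ v) := by
  have h : v ⬝ᵥ (Matrix.of (fun i j => rkhsKernel H (x i) (x j)) *ᵥ v)
      = ‖∑ i, v i • RKHS.kerFun H (x i) (1 : ℝ)‖ ^ 2 := by
    rw [← real_inner_self_eq_norm_sq, sum_inner]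
    simp only [inner_sum, inner_smul_left, inner_smul_right, dotProduct, Matrix.mulVec,
      Matrix.of_apply, rkhsKernel_eq_inner, Finset.mul_sum]
    refine Finset.sum_congr rfl fun i _ => Finset.sum_congr rfl fun j _ => ?_
    simp; ring
  rw [ridgeMatrix, Matrix.add_mulVec, Matrix.smul_mulVec, Matrix.one_mulVec, dotProduct_add, h,
    dotProduct_smul, smul_eq_mul]
  nlinarith [sq_nonneg ‖∑ i, v i • RKHS.kerFun H (x i) (1 : ℝ)‖]

lemma ridgeMatrix_transpose {n : ℕ} (ρ : ℝ) (x : Fin n → 𝒳) :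
    (ridgeMatrix (rkhsKernel H) ρ x)ᵀ = ridgeMatrix (rkhsKernel H) ρ x := by
  ext i j
  simp [ridgeMatrix, rkhsKernel_comm (x i) (x j), Matrix.one_apply, eq_comm]

lemma ridgeMatrix_inv_transpose {n : ℕ} (ρ : ℝ) (x : Fin n → 𝒳) :
    ((ridgeMatrix (rkhsKernel H) ρ x)⁻¹)ᵀ = (ridgeMatrix (rkhsKernel H) ρ x)⁻¹ := by
  rw [Matrix.transpose_nonsing_inv, ridgeMatrix_transpose]

/-- The representer theorem for kernel ridge regression, with explicit coefficients. -/
lemma IsKRRSolution.apply_eq {n : ℕ} {ρ : ℝ} (hρ : 0 < ρ) {x : Fin n → 𝒳} {y : Fin n → ℝ} {f : H}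
    (hf : IsKRRSolution ρ x y f) (z : 𝒳) :
    f z = ∑ l, y l * ∑ i, (ridgeMatrix (rkhsKernel H) ρ x)⁻¹ i l * rkhsKernel H (x i) z := by
  -- Stationarity tested against the kernel section at `z` expands `f` in the kernels at the sample
  -- points, with scaled residuals as coefficients. Evaluating that expansion at the sample points
  -- yields `(K + ρ) α = y`.
  set α : Fin n → ℝ := fun i => (y i - f (x i)) / ρ with hα
  have hrep : ∀ z, f z = ∑ i, α i * rkhsKernel H (x i) z := fun z => by
    have h := hf.stationary (RKHS.kerFun H z (1 : ℝ))
    rw [← rkhs_apply_eq_inner] at h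
    have h1 : ∀ i, (RKHS.kerFun H z (1 : ℝ)) (x i) = rkhsKernel H (x i) z := fun i => by
      rw [RKHS.kerFun_apply]; rfl
    simp only [h1] at h
    have h2 : ρ * f z = ρ * ∑ i, α i * rkhsKernel H (x i) z := by
      rw [Finset.mul_sum, eq_neg_of_add_eq_zero_right h, ← Finset.sum_neg_distrib]
      refine Finset.sum_congr rfl fun i _ => ?_
      rw [hα]; field_simp; ring
    exact mul_left_cancel₀ hρ.ne' h2
  have hlin : ridgeMatrix (rkhsKernel H) ρ x *ᵥ α = y := by
    ext j
    rw [ridgeMatrix, Matrix.add_mulVec, Matrix.smul_mulVec, Matrix.one_mulVec]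
    have h1 : (Matrix.of (fun i j => rkhsKernel H (x i) (x j)) *ᵥ α) j = f (x j) := by
      rw [hrep, Matrix.mulVec, dotProduct]
      refine Finset.sum_congr rfl fun i _ => ?_
      rw [Matrix.of_apply, rkhsKernel_comm, mul_comm]
    rw [Pi.add_apply, h1, Pi.smul_apply, smul_eq_mul, hα]
    field_simp; ring
  have hinv : α = (ridgeMatrix (rkhsKernel H) ρ x)⁻¹ *ᵥ y := by
    rw [← hlin, Matrix.mulVec_mulVec,
      Matrix.nonsing_inv_mul _ (isUnit_det_of_coercive hρ (ridgeMatrix_coercive ρ x)),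
      Matrix.one_mulVec]
  rw [hrep, hinv]
  simp only [Matrix.mulVec, dotProduct, Finset.sum_mul, Finset.mul_sum]
  rw [Finset.sum_comm]
  exact Finset.sum_congr rfl fun i _ => Finset.sum_congr rfl fun j _ => by ring

end RKHS

/-! ### Measurability of the inverse Gram matrix -/

lemma measurable_det_of_apply {α : Type*} [MeasurableSpace α] {n : ℕ}
    {A : α → Matrix (Fin n) (Fin n) ℝ} (hA : ∀ i j, Measurable fun x => A x i j) :
    Measurable fun x => (A x).det := by
  simp only [Matrix.det_apply]
  exact Finset.measurable_fun_sum _ fun s _ =>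
    (Finset.measurable_fun_prod _ fun i _ => hA (s i) i).const_smul (Equiv.Perm.sign s)

/-- Cramer's rule writes the entries through determinants. Singular matrices need no care, real
inversion with `0⁻¹ = 0` being measurable. -/
lemma measurable_inv_apply_of_apply {α : Type*} [MeasurableSpace α] {n : ℕ}
    {A : α → Matrix (Fin n) (Fin n) ℝ} (hA : ∀ i j, Measurable fun x => A x i j) (i j : Fin n) :
    Measurable fun x => (A x)⁻¹ i j := by
  simp only [Matrix.inv_def, Matrix.smul_apply, smul_eq_mul, Ring.inverse_eq_inv',
    Matrix.adjugate_apply]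
  refine (measurable_det_of_apply hA).inv.mul (measurable_det_of_apply fun a b => ?_)
  by_cases h : a = j
  · subst h
    simp only [Matrix.updateRow_self]
    exact measurable_const
  · simp only [Matrix.updateRow_ne h]
    exact hA a b

lemma measurable_ridgeMatrix_inv_apply {𝒳 : Type*} [MeasurableSpace 𝒳] {k : 𝒳 → 𝒳 → ℝ}
    (hk : Measurable (fun p : 𝒳 × 𝒳 => k p.1 p.2)) {n : ℕ} (ρ : ℝ) (i j : Fin n) :
    Measurable (fun x : Fin n → 𝒳 => (ridgeMatrix k ρ x)⁻¹ i j) := by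
  refine measurable_inv_apply_of_apply (fun i j => ?_) i j
  have h1 : Measurable (fun x : Fin n → 𝒳 => k (x i) (x j)) :=
    hk.comp (f := fun x : Fin n → 𝒳 => (x i, x j))
      ((measurable_pi_apply i).prodMk (measurable_pi_apply j))
  simpa [ridgeMatrix] using h1.add_const _

/-! ### Orbit averaging as an orthogonal projection -/

lemma abs_orbitAverage_le {𝒳 G : Type*} [SMul G 𝒳] [MeasurableSpace G]
    {lam : Measure G} [IsProbabilityMeasure lam] {φ : 𝒳 → ℝ} {C : ℝ} (hC : ∀ x, |φ x| ≤ C) (x : 𝒳) :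
    |orbitAverage lam φ x| ≤ C := by
  have := norm_integral_le_of_norm_le_const (μ := lam) (f := fun g : G => φ (g • x)) (C := C)
    (Filter.Eventually.of_forall fun g => hC (g • x))
  simpa [orbitAverage] using this

/-- A right translate of Haar measure is again a Haar probability measure, so uniqueness makes `lam`
right-invariant. Right translation is a measurable embedding, hence `φ` may be arbitrary. -/
lemma orbitAverage_smul {𝒳 G : Type*} [Group G] [MulAction G 𝒳] [MeasurableSpace G]
    {lam : Measure G} [IsProbabilityMeasure lam] [TopologicalSpace G] [IsTopologicalGroup G]
    [CompactSpace G] [BorelSpace G] [SecondCountableTopology G] [lam.IsHaarMeasure]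
    (φ : 𝒳 → ℝ) (g : G) (x : 𝒳) :
    orbitAverage lam φ (g • x) = orbitAverage lam φ x := by
  have hmap : lam.map (fun a => a * g) = lam := by
    have : IsProbabilityMeasure (lam.map (fun a => a * g)) :=
      Measure.isProbabilityMeasure_map (measurable_mul_const g).aemeasurable
    exact Measure.isHaarMeasure_eq_of_isProbabilityMeasure _ _
  have he : MeasurableEmbedding (fun a : G => a * g) :=
    (Homeomorph.mulRight g).measurableEmbedding
  simp only [orbitAverage]
  conv_rhs => rw [← hmap, he.integral_map]
  simp only [smul_smul]

section Averaging

variable {𝒳 : Type*} [MeasurableSpace 𝒳] {G : Type*} [Group G] [MeasurableSpace G]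
  [MulAction G 𝒳] [MeasurableSMul₂ G 𝒳] {lam : Measure G} [IsProbabilityMeasure lam]

lemma integrable_of_abs_le {α : Type*} [MeasurableSpace α] {ν : Measure α} [IsFiniteMeasure ν]
    {φ : α → ℝ} {C : ℝ} (hφ : AEStronglyMeasurable φ ν) (hC : ∀ x, |φ x| ≤ C) :
    Integrable φ ν :=
  Integrable.of_bound hφ C (Filter.Eventually.of_forall hC)

lemma integrable_orbit {φ : 𝒳 → ℝ} {C : ℝ} (hφ : Measurable φ) (hC : ∀ x, |φ x| ≤ C) (x : 𝒳) :
    Integrable (fun g : G => φ (g • x)) lam :=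
  integrable_of_abs_le (hφ.comp (measurable_smul_const x)).aestronglyMeasurable fun _ => hC _

lemma measurable_orbitAverage_param {W : Type*} [MeasurableSpace W] {a : W → 𝒳 → ℝ}
    (ha : Measurable fun p : W × 𝒳 => a p.1 p.2) :
    Measurable fun p : W × 𝒳 => orbitAverage lam (a p.1) p.2 := by
  have h : Measurable fun q : (W × 𝒳) × G => a q.1.1 (q.2 • q.1.2) :=
    ha.comp (f := fun q : (W × 𝒳) × G => (q.1.1, q.2 • q.1.2))
      ((measurable_fst.comp measurable_fst).prodMk
        (measurable_snd.smul (measurable_snd.comp measurable_fst)))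
  exact (h.stronglyMeasurable.integral_prod_right (ν := lam)).measurable

lemma measurable_orbitAverage {φ : 𝒳 → ℝ} (hφ : Measurable φ) :
    Measurable (orbitAverage lam φ) :=
  (measurable_orbitAverage_param (W := Unit) (a := fun _ => φ) (lam := lam)
    (hφ.comp measurable_snd)).comp ((measurable_const (a := ())).prodMk measurable_id)

lemma orbitAverage_sum_mul {n : ℕ} {φ : Fin n → 𝒳 → ℝ} {C : ℝ} (hφ : ∀ i, Measurable (φ i))
    (hC : ∀ i x, |φ i x| ≤ C) (y : Fin n → ℝ) (x : 𝒳) :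
    orbitAverage lam (fun z => ∑ i, y i * φ i z) x = ∑ i, y i * orbitAverage lam (φ i) x := by
  simp only [orbitAverage]
  rw [integral_finsetSum _ fun i _ => (integrable_orbit (hφ i) (hC i) x).const_mul (y i)]
  simp only [integral_const_mul]

variable {μ : Measure 𝒳} [IsProbabilityMeasure μ]

/-- Fubini moves the group integral outside; for each fixed `g`, invariance of `u` and of `μ` turns
the inner integral into `∫ φ u`. -/
lemma integral_sub_orbitAverage_mul {φ u : 𝒳 → ℝ} {C : ℝ}
    (hμ : ∀ g : G, μ.map (fun x => g • x) = μ) (hφ : Measurable φ)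
    (hC : ∀ x, |φ x| ≤ C) (hu : Integrable u μ) (hinv : ∀ g : G, ∀ᵐ x ∂μ, u (g • x) = u x) :
    ∫ x, (φ x - orbitAverage lam φ x) * u x ∂μ = 0 := by
  have h1 : Integrable (fun x => φ x * u x) μ :=
    hu.bdd_mul hφ.aestronglyMeasurable (Filter.Eventually.of_forall hC)
  have h2 : Integrable (fun x => orbitAverage lam φ x * u x) μ :=
    hu.bdd_mul (measurable_orbitAverage hφ).aestronglyMeasurable
      (Filter.Eventually.of_forall fun x => abs_orbitAverage_le hC x)
  have h3 : Integrable (Function.uncurry fun (x : 𝒳) (g : G) => φ (g • x) * u x)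
      (μ.prod lam) := by
    refine (hu.comp_fst lam).bdd_mul (c := C) ?_ (Filter.Eventually.of_forall fun p => hC _)
    exact (hφ.comp (measurable_snd.smul measurable_fst)).aestronglyMeasurable
  have hswap : ∫ x, orbitAverage lam φ x * u x ∂μ = ∫ g, ∫ x, φ (g • x) * u x ∂μ ∂lam := by
    rw [← integral_integral_swap h3]
    simp only [orbitAverage, integral_mul_const]
  have hin : ∀ g : G, ∫ x, φ (g • x) * u x ∂μ = ∫ x, φ x * u x ∂μ := fun g => by
    have he : MeasurableEmbedding (fun x : 𝒳 => g • x) := measurableEmbedding_const_smul g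
    calc ∫ x, φ (g • x) * u x ∂μ = ∫ x, φ (g • x) * u (g • x) ∂μ := by
          refine integral_congr_ae ?_
          filter_upwards [hinv g] with x hx
          rw [hx]
      _ = ∫ x, φ x * u x ∂(μ.map fun x => g • x) :=
          (he.integral_map (fun x => φ x * u x)).symm
      _ = _ := by rw [hμ g]
  simp only [sub_mul]
  rw [integral_sub h1 h2, hswap]
  simp [hin]

lemma memLp_two_of_abs_le {φ : 𝒳 → ℝ} {C : ℝ} (hφ : Measurable φ) (hC : ∀ x, |φ x| ≤ C) :
    MemLp φ 2 μ :=
  MemLp.of_bound hφ.aestronglyMeasurable C (Filter.Eventually.of_forall hC)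

/-- Pythagoras for averaging: the excess risk of a predictor over its average. -/
lemma integral_sub_sq_eq_orbitAverage_add [TopologicalSpace G] [IsTopologicalGroup G]
    [CompactSpace G] [BorelSpace G] [SecondCountableTopology G] [lam.IsHaarMeasure]
    {φ u : 𝒳 → ℝ} {C : ℝ}
    (hμ : ∀ g : G, μ.map (fun x => g • x) = μ) (hφ : Measurable φ)
    (hC : ∀ x, |φ x| ≤ C) (hu : MemLp u 2 μ) (hinv : ∀ g : G, ∀ᵐ x ∂μ, u (g • x) = u x) :
    ∫ x, (φ x - u x) ^ 2 ∂μ = ∫ x, (orbitAverage lam φ x - u x) ^ 2 ∂μ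
      + sqNormL2 μ (fun x => φ x - orbitAverage lam φ x) := by
  have hO : MemLp (orbitAverage lam φ) 2 μ :=
    memLp_two_of_abs_le (measurable_orbitAverage hφ) (abs_orbitAverage_le hC)
  have hF : MemLp φ 2 μ := memLp_two_of_abs_le hφ hC
  have hd : MemLp (fun x => orbitAverage lam φ x - u x) 2 μ := hO.sub hu
  have hp : MemLp (fun x => φ x - orbitAverage lam φ x) 2 μ := hF.sub hO
  -- The second factor `O φ - u` is itself invariant, hence orthogonal to `φ - O φ`.
  have hz : ∫ x, (φ x - orbitAverage lam φ x) * (orbitAverage lam φ x - u x) ∂μ = 0 := by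
    refine integral_sub_orbitAverage_mul hμ hφ hC (hd.integrable one_le_two) fun g => ?_
    filter_upwards [hinv g] with x hx
    rw [hx, orbitAverage_smul]
  have hi : Integrable (fun x => (φ x - orbitAverage lam φ x) * (orbitAverage lam φ x - u x)) μ :=
    hp.integrable_mul hd
  have e : ∀ x, (φ x - u x) ^ 2 = ((orbitAverage lam φ x - u x) ^ 2
      + (φ x - orbitAverage lam φ x) ^ 2)
      + 2 * ((φ x - orbitAverage lam φ x) * (orbitAverage lam φ x - u x)) := fun x => by ring
  have hs : Integrable (fun x => (orbitAverage lam φ x - u x) ^ 2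
      + (φ x - orbitAverage lam φ x) ^ 2) μ := hd.integrable_sq.add hp.integrable_sq
  simp only [e]
  rw [integral_add hs (hi.const_mul 2),
    integral_add hd.integrable_sq hp.integrable_sq, integral_const_mul, hz, sqNormL2]
  ring

end Averaging

/-! ### Conditioning and the risk -/

/-- A factor whose conditional expectation is constant can be pulled out of an expectation. -/
lemma integral_mul_of_condExp_eq_const {Ω : Type*} {m m0 : MeasurableSpace Ω} {P : Measure Ω}
    [IsProbabilityMeasure P] {c ζ : Ω → ℝ} {t : ℝ} (hm : m ≤ m0)
    (hc : AEStronglyMeasurable[m] c P) (hcζ : Integrable (c * ζ) P) (hζ : Integrable ζ P)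
    (ht : P[ζ | m] =ᵐ[P] fun _ => t) : ∫ ω, c ω * ζ ω ∂P = t * ∫ ω, c ω ∂P := by
  have h1 := condExp_mul_of_aestronglyMeasurable_left hc hcζ hζ
  calc ∫ ω, c ω * ζ ω ∂P = ∫ ω, (P[c * ζ | m]) ω ∂P := (integral_condExp hm).symm
    _ = ∫ ω, t * c ω ∂P := by
        refine integral_congr_ae ?_
        filter_upwards [h1, ht] with ω h2 h3
        rw [h2, Pi.mul_apply, h3, mul_comm]
    _ = t * ∫ ω, c ω ∂P := integral_const_mul _ _

/-- Bias and noise decomposition of the risk of a square-integrable predictor. -/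
lemma risk_eq_integral_sub_sq_add {𝒳 : Type*} [MeasurableSpace 𝒳] {μ : Measure 𝒳}
    {Ω : Type*} [MeasurableSpace Ω] {P : Measure Ω} [IsProbabilityMeasure P]
    {X : Ω → 𝒳} {Y ξ : Ω → ℝ} {fstar h : 𝒳 → ℝ} {σ : ℝ} (hX : Measurable X)
    (hXμ : P.map X = μ) (hY : ∀ᵐ ω ∂P, Y ω = fstar (X ω) + ξ ω) (hξ : MemLp ξ 2 P)
    (hξ_mean : P[ξ | MeasurableSpace.comap X inferInstance] =ᵐ[P] fun _ => 0)
    (hξ_var : ∫ ω, ξ ω ^ 2 ∂P = σ ^ 2) (hfstar : MemLp fstar 2 μ) (hh : MemLp h 2 μ) :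
    risk P X Y h = ∫ x, (h x - fstar x) ^ 2 ∂μ + σ ^ 2 := by
  subst hXμ
  have hd : MemLp (fun x => h x - fstar x) 2 (P.map X) := hh.sub hfstar
  have hdX : MemLp (fun ω => h (X ω) - fstar (X ω)) 2 P := hd.comp_of_map hX.aemeasurable
  have hprod : Integrable ((fun ω => h (X ω) - fstar (X ω)) * ξ) P := hdX.integrable_mul hξ
  have hm : MeasurableSpace.comap X inferInstance ≤ (inferInstance : MeasurableSpace Ω) :=
    hX.comap_le
  have hmeas : AEStronglyMeasurable[MeasurableSpace.comap X inferInstance]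
      (fun ω => h (X ω) - fstar (X ω)) P := by
    -- The difference is only a.e. measurable on `𝒳`; a strongly measurable version composed with
    -- `X` is measurable for the σ-algebra of `X`.
    obtain ⟨v, hv, hve⟩ := hd.aestronglyMeasurable
    exact ⟨v ∘ X, hv.comp_measurable (comap_measurable X),
      ae_of_ae_map hX.aemeasurable hve⟩
  have hcross : ∫ ω, (h (X ω) - fstar (X ω)) * ξ ω ∂P = 0 := by
    rw [integral_mul_of_condExp_eq_const hm hmeas hprod (hξ.integrable one_le_two) hξ_mean,
      zero_mul]
  have hs : Integrable (fun ω => (h (X ω) - fstar (X ω)) ^ 2 + ξ ω ^ 2) P :=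
    hdX.integrable_sq.add hξ.integrable_sq
  have hprod' : Integrable (fun ω => 2 * ((h (X ω) - fstar (X ω)) * ξ ω)) P := hprod.const_mul 2
  have e : ∀ᵐ ω ∂P, (h (X ω) - Y ω) ^ 2 = ((h (X ω) - fstar (X ω)) ^ 2 + ξ ω ^ 2)
      - 2 * ((h (X ω) - fstar (X ω)) * ξ ω) := by
    filter_upwards [hY] with ω hω
    rw [hω]; ring
  rw [risk, integral_congr_ae e, integral_sub hs hprod',
    integral_add hdX.integrable_sq hξ.integrable_sq, integral_const_mul,
    hcross, hξ_var, integral_map hX.aemeasurable (hd.integrable_sq.aestronglyMeasurable)]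
  simp

/-! ### Linear smoothers with bounded weights -/

lemma abs_mul_le_sq {𝒳 W : Type*} {n : ℕ} {a : Fin n → W → 𝒳 → ℝ} {C : ℝ}
    (hC : ∀ l w z, |a l w z| ≤ C) (l m : Fin n) (w : W) (z : 𝒳) :
    |a l w z * a m w z| ≤ C ^ 2 := by
  rw [abs_mul, pow_two]
  exact mul_le_mul (hC l w z) (hC m w z) (abs_nonneg _) ((abs_nonneg _).trans (hC l w z))

lemma abs_sum_mul_weight_le {𝒳 W : Type*} {n : ℕ} {a : Fin n → W → 𝒳 → ℝ} {C : ℝ}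
    (hC : ∀ l w z, |a l w z| ≤ C) (y : Fin n → ℝ) (w : W) (z : 𝒳) :
    |∑ l, y l * a l w z| ≤ ∑ l, |y l| * C :=
  (Finset.abs_sum_le_sum_abs _ _).trans <| Finset.sum_le_sum fun l _ => by
    rw [abs_mul]; exact mul_le_mul_of_nonneg_left (hC l w z) (abs_nonneg _)

lemma integrable_bdd_mul_mul {Ω : Type*} [MeasurableSpace Ω] {P : Measure Ω} {d u v : Ω → ℝ} {K : ℝ}
    (hd : Measurable d) (hK : ∀ ω, |d ω| ≤ K) (hu : MemLp u 2 P) (hv : MemLp v 2 P) :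
    Integrable (fun ω => d ω * u ω * v ω) P := by
  simp only [mul_assoc]
  exact (hu.integrable_mul hv).bdd_mul hd.aestronglyMeasurable (Filter.Eventually.of_forall hK)

/-- The Gram matrix in `L₂(μ)` of the weight functions of a linear smoother. -/
noncomputable def weightGram {𝒳 W : Type*} [MeasurableSpace 𝒳] {n : ℕ} (μ : Measure 𝒳)
    (a : Fin n → W → 𝒳 → ℝ) (l m : Fin n) (w : W) : ℝ :=
  ∫ z, a l w z * a m w z ∂μ

lemma abs_weightGram_le {𝒳 W : Type*} [MeasurableSpace 𝒳] {μ : Measure 𝒳}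
    [IsProbabilityMeasure μ] {n : ℕ} {a : Fin n → W → 𝒳 → ℝ} {C : ℝ}
    (hC : ∀ l w z, |a l w z| ≤ C) (l m : Fin n) (w : W) :
    |weightGram μ a l m w| ≤ C ^ 2 := by
  have := norm_integral_le_of_norm_le_const (μ := μ) (f := fun z => a l w z * a m w z)
    (C := C ^ 2) (Filter.Eventually.of_forall (abs_mul_le_sq hC l m w))
  simpa [weightGram] using this

section LinearSmoother

variable {𝒳 W Ω : Type*} [MeasurableSpace 𝒳] [MeasurableSpace W] [MeasurableSpace Ω]
  {μ : Measure 𝒳} [IsProbabilityMeasure μ] {P : Measure Ω}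
  {n : ℕ} {a : Fin n → W → 𝒳 → ℝ} {C : ℝ} {Z : Ω → W}

lemma measurable_section (ha : ∀ l, Measurable fun p : W × 𝒳 => a l p.1 p.2) (l : Fin n) (w : W) :
    Measurable (a l w) :=
  (ha l).comp (measurable_const.prodMk measurable_id)

lemma integrable_weight_mul (ha : ∀ l, Measurable fun p : W × 𝒳 => a l p.1 p.2)
    (hC : ∀ l w z, |a l w z| ≤ C) (l m : Fin n) (w : W) :
    Integrable (fun z => a l w z * a m w z) μ :=
  integrable_of_abs_le
    ((measurable_section ha l w).mul (measurable_section ha m w)).aestronglyMeasurable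
    (abs_mul_le_sq hC l m w)

lemma measurable_weightGram (ha : ∀ l, Measurable fun p : W × 𝒳 => a l p.1 p.2) (l m : Fin n) :
    Measurable (weightGram μ a l m) :=
  (((ha l).mul (ha m)).stronglyMeasurable.integral_prod_right (ν := μ)).measurable

/-- The norm becomes a quadratic form in the responses whose coefficients depend on the inputs
alone, and so can be pulled out when conditioning on them. -/
lemma sqNormL2_sum_mul (ha : ∀ l, Measurable fun p : W × 𝒳 => a l p.1 p.2)
    (hC : ∀ l w z, |a l w z| ≤ C) (y : Fin n → ℝ) (w : W) :
    sqNormL2 μ (fun z => ∑ l, y l * a l w z)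
      = ∑ l, ∑ m, weightGram μ a l m w * y l * y m := by
  have e : ∀ z, (∑ l, y l * a l w z) ^ 2 = ∑ l, ∑ m, (y l * y m) * (a l w z * a m w z) :=
    fun z => by
      rw [pow_two, Finset.sum_mul_sum]
      exact Finset.sum_congr rfl fun l _ => Finset.sum_congr rfl fun m _ => by ring
  simp only [sqNormL2, e]
  rw [integral_finsetSum _ fun l _ => integrable_finsetSum _ fun m _ =>
    (integrable_weight_mul ha hC l m w).const_mul _]
  refine Finset.sum_congr rfl fun l _ => ?_
  rw [integral_finsetSum _ fun m _ => (integrable_weight_mul ha hC l m w).const_mul _]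
  refine Finset.sum_congr rfl fun m _ => ?_
  rw [integral_const_mul, weightGram]
  ring

lemma integrable_weightGram_mul_mul (hZ : Measurable Z)
    (ha : ∀ l, Measurable fun p : W × 𝒳 => a l p.1 p.2)
    (hC : ∀ l w z, |a l w z| ≤ C) {u v : Ω → ℝ} (hu : MemLp u 2 P) (hv : MemLp v 2 P)
    (l m : Fin n) : Integrable (fun ω => weightGram μ a l m (Z ω) * u ω * v ω) P :=
  integrable_bdd_mul_mul ((measurable_weightGram ha l m).comp hZ)
    (fun _ => abs_weightGram_le hC l m _) hu hv

lemma integrable_sqNormL2_smoother (hZ : Measurable Z)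
    (ha : ∀ l, Measurable fun p : W × 𝒳 => a l p.1 p.2)
    (hC : ∀ l w z, |a l w z| ≤ C) {y : Fin n → Ω → ℝ} (hy : ∀ l, MemLp (y l) 2 P) :
    Integrable (fun ω => sqNormL2 μ (fun z => ∑ l, y l ω * a l (Z ω) z)) P := by
  simp only [sqNormL2_sum_mul ha hC]
  exact integrable_finsetSum _ fun l _ => integrable_finsetSum _ fun m _ =>
    integrable_weightGram_mul_mul hZ ha hC (hy l) (hy m) l m

lemma measurable_sum_mul_weight (ha : ∀ l, Measurable fun p : W × 𝒳 => a l p.1 p.2)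
    (y : Fin n → ℝ) (w : W) : Measurable fun z => ∑ l, y l * a l w z :=
  Finset.measurable_fun_sum _ fun l _ => (measurable_section ha l w).const_mul _

variable [IsProbabilityMeasure P]

lemma integrable_smoother_sub_sq (hZ : Measurable Z)
    (ha : ∀ l, Measurable fun p : W × 𝒳 => a l p.1 p.2)
    (hC : ∀ l w z, |a l w z| ≤ C) {y : Fin n → Ω → ℝ} (hy : ∀ l, MemLp (y l) 2 P)
    {u : 𝒳 → ℝ} (hu : MemLp u 2 μ) :
    Integrable (fun ω => ∫ z, (∑ l, y l ω * a l (Z ω) z - u z) ^ 2 ∂μ) P := by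
  -- A strongly measurable version of `u` makes the cross coefficients `e l` measurable as
  -- parametrised integrals.
  obtain ⟨v, hv, huv⟩ := hu.aestronglyMeasurable
  have hv2 : MemLp v 2 μ := (memLp_congr_ae huv).1 hu
  have hvi : Integrable v μ := hv2.integrable one_le_two
  set e : Fin n → W → ℝ := fun l w => ∫ z, a l w z * v z ∂μ with he
  have hae : ∀ l w, Integrable (fun z => a l w z * v z) μ := fun l w =>
    hvi.bdd_mul (measurable_section ha l w).aestronglyMeasurable
      (Filter.Eventually.of_forall (hC l w))
  have hem : ∀ l, Measurable (e l) := fun l =>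
    (((ha l).mul (hv.measurable.comp measurable_snd)).stronglyMeasurable.integral_prod_right
      (ν := μ)).measurable
  have heb : ∀ l w, |e l w| ≤ ∫ z, C * |v z| ∂μ := fun l w => by
    refine (abs_integral_le_integral_abs).trans ?_
    refine integral_mono (hae l w).abs (hvi.abs.const_mul C) fun z => ?_
    simp only [abs_mul]
    exact mul_le_mul_of_nonneg_right (hC l w z) (abs_nonneg _)
  have hexp : ∀ ω, ∫ z, (∑ l, y l ω * a l (Z ω) z - u z) ^ 2 ∂μ
      = sqNormL2 μ (fun z => ∑ l, y l ω * a l (Z ω) z) - 2 * ∑ l, e l (Z ω) * y l ω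
        + ∫ z, v z ^ 2 ∂μ := fun ω => by
    have hS : MemLp (fun z => ∑ l, y l ω * a l (Z ω) z) 2 μ :=
      memLp_two_of_abs_le (measurable_sum_mul_weight ha _ _) (abs_sum_mul_weight_le hC _ _)
    have hSv : Integrable (fun z => (∑ l, y l ω * a l (Z ω) z) * v z) μ := hS.integrable_mul hv2
    have h2 : Integrable (fun z => 2 * ((∑ l, y l ω * a l (Z ω) z) * v z)) μ := hSv.const_mul 2
    have h3 : Integrable (fun z => (∑ l, y l ω * a l (Z ω) z) ^ 2
        - 2 * ((∑ l, y l ω * a l (Z ω) z) * v z)) μ := hS.integrable_sq.sub h2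
    have hcross : ∫ z, (∑ l, y l ω * a l (Z ω) z) * v z ∂μ = ∑ l, e l (Z ω) * y l ω := by
      simp only [Finset.sum_mul, mul_assoc]
      rw [integral_finsetSum _ fun l _ => (hae l (Z ω)).const_mul _]
      refine Finset.sum_congr rfl fun l _ => ?_
      rw [integral_const_mul, mul_comm]
    calc ∫ z, (∑ l, y l ω * a l (Z ω) z - u z) ^ 2 ∂μ
        = ∫ z, (((∑ l, y l ω * a l (Z ω) z) ^ 2
            - 2 * ((∑ l, y l ω * a l (Z ω) z) * v z)) + v z ^ 2) ∂μ := by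
          refine integral_congr_ae ?_
          filter_upwards [huv] with z hz
          rw [hz]; ring
      _ = _ := by
          rw [integral_add h3 hv2.integrable_sq, integral_sub hS.integrable_sq h2,
            integral_const_mul, hcross, sqNormL2]
  simp only [hexp]
  refine ((integrable_sqNormL2_smoother hZ ha hC hy).sub (Integrable.const_mul ?_ 2)).add
    (integrable_const _)
  exact integrable_finsetSum _ fun l _ => ((hy l).integrable one_le_two).bdd_mul
    ((hem l).comp hZ).aestronglyMeasurable (Filter.Eventually.of_forall fun ω => heb l (Z ω))

/-- The variance of the noise is added to the bias of a linear smoother. -/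
lemma integral_sqNormL2_smoother_add_noise (hZ : Measurable Z)
    (ha : ∀ l, Measurable fun p : W × 𝒳 => a l p.1 p.2)
    (hC : ∀ l w z, |a l w z| ≤ C) {u ξ : Fin n → Ω → ℝ} {σ : ℝ} (hu : ∀ l, MemLp (u l) 2 P)
    (hum : ∀ l, AEStronglyMeasurable[MeasurableSpace.comap Z inferInstance] (u l) P)
    (hξ : ∀ l, MemLp (ξ l) 2 P)
    (hξ_mean : ∀ l, P[ξ l | MeasurableSpace.comap Z inferInstance] =ᵐ[P] fun _ => 0)
    (hξ_cov : ∀ l m, P[fun ω => ξ l ω * ξ m ω | MeasurableSpace.comap Z inferInstance] =ᵐ[P]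
      fun _ => if l = m then σ ^ 2 else 0) :
    ∫ ω, sqNormL2 μ (fun z => ∑ l, (u l ω + ξ l ω) * a l (Z ω) z) ∂P
      = ∫ ω, sqNormL2 μ (fun z => ∑ l, u l ω * a l (Z ω) z) ∂P
        + σ ^ 2 * ∑ l, ∫ ω, weightGram μ a l l (Z ω) ∂P := by
  have hm := hZ.comap_le
  have hGm : ∀ l m, AEStronglyMeasurable[MeasurableSpace.comap Z inferInstance] 
        (fun ω => weightGram μ a l m (Z ω)) P := fun l m =>
    (((measurable_weightGram ha l m).comp
      (comap_measurable Z)).stronglyMeasurable).aestronglyMeasurable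
  have hI : ∀ {p q : Ω → ℝ}, MemLp p 2 P → MemLp q 2 P → ∀ l m,
      Integrable (fun ω => weightGram μ a l m (Z ω) * p ω * q ω) P := fun hp hq l m =>
    integrable_weightGram_mul_mul hZ ha hC hp hq l m
  -- Gram entry and signal are functions of the inputs, up to null sets, so the centred noise
  -- removes both mixed terms; the covariance then keeps only the diagonal of the noise term.
  have h1 : ∀ l m, ∫ ω, weightGram μ a l m (Z ω) * u l ω * ξ m ω ∂P = 0 := fun l m => by
    rw [integral_mul_of_condExp_eq_const (c := fun ω => weightGram μ a l m (Z ω) * u l ω) hm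
      ((hGm l m).mul (hum l)) (hI (hu l) (hξ m) l m) ((hξ m).integrable one_le_two) (hξ_mean m),
      zero_mul]
  have h2 : ∀ l m, ∫ ω, weightGram μ a l m (Z ω) * ξ l ω * u m ω ∂P = 0 := fun l m => by
    have e : ∀ ω, weightGram μ a l m (Z ω) * ξ l ω * u m ω
        = weightGram μ a l m (Z ω) * u m ω * ξ l ω := fun ω => by ring
    have hi := hI (hu m) (hξ l) l m
    simp only [e]
    rw [integral_mul_of_condExp_eq_const (c := fun ω => weightGram μ a l m (Z ω) * u m ω) hm
      ((hGm l m).mul (hum m)) hi ((hξ l).integrable one_le_two) (hξ_mean l), zero_mul]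
  have h3 : ∀ l m, ∫ ω, weightGram μ a l m (Z ω) * ξ l ω * ξ m ω ∂P
      = (if l = m then σ ^ 2 else 0) * ∫ ω, weightGram μ a l m (Z ω) ∂P := fun l m => by
    have hi := hI (hξ l) (hξ m) l m
    simp only [mul_assoc] at hi ⊢
    exact integral_mul_of_condExp_eq_const (ζ := fun ω => ξ l ω * ξ m ω) hm (hGm l m) hi
      ((hξ l).integrable_mul (hξ m)) (hξ_cov l m)
  have hterm : ∀ l m, ∫ ω, weightGram μ a l m (Z ω) * (u l ω + ξ l ω) * (u m ω + ξ m ω) ∂P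
      = ∫ ω, weightGram μ a l m (Z ω) * u l ω * u m ω ∂P
        + (if l = m then σ ^ 2 else 0) * ∫ ω, weightGram μ a l m (Z ω) ∂P := fun l m => by
    have e : ∀ ω, weightGram μ a l m (Z ω) * (u l ω + ξ l ω) * (u m ω + ξ m ω)
        = ((weightGram μ a l m (Z ω) * u l ω * u m ω + weightGram μ a l m (Z ω) * u l ω * ξ m ω)
          + weightGram μ a l m (Z ω) * ξ l ω * u m ω)
          + weightGram μ a l m (Z ω) * ξ l ω * ξ m ω := fun ω => by ring
    have i1 := hI (hu l) (hu m) l m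
    have i2 := hI (hu l) (hξ m) l m
    have i3 := hI (hξ l) (hu m) l m
    have i4 := hI (hξ l) (hξ m) l m
    simp only [e]
    rw [integral_add (f := fun ω => (weightGram μ a l m (Z ω) * u l ω * u m ω
          + weightGram μ a l m (Z ω) * u l ω * ξ m ω) + weightGram μ a l m (Z ω) * ξ l ω * u m ω)
        ((i1.add i2).add i3) i4,
      integral_add (f := fun ω => weightGram μ a l m (Z ω) * u l ω * u m ω
          + weightGram μ a l m (Z ω) * u l ω * ξ m ω) (i1.add i2) i3,
      integral_add i1 i2, h1, h2, h3]
    ring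
  have hs : ∀ l, MemLp (fun ω => u l ω + ξ l ω) 2 P := fun l => (hu l).add (hξ l)
  simp only [sqNormL2_sum_mul ha hC]
  rw [integral_finsetSum _ fun l _ => integrable_finsetSum _ fun m _ =>
      hI (hs l) (hs m) l m,
    integral_finsetSum _ fun l _ => integrable_finsetSum _ fun m _ => hI (hu l) (hu m) l m,
    Finset.mul_sum, ← Finset.sum_add_distrib]
  refine Finset.sum_congr rfl fun l _ => ?_
  rw [integral_finsetSum _ fun m _ => hI (hs l) (hs m) l m,
    integral_finsetSum _ fun m _ => hI (hu l) (hu m) l m]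
  refine (Finset.sum_congr rfl fun m _ => hterm l m).trans ?_
  rw [Finset.sum_add_distrib]
  simp

end LinearSmoother

/-! ### Ridge weights and the kernel term -/

/-- The weight of the `l`-th response in the ridge regression predictor at `z`. -/
noncomputable def ridgeWeight {𝒳 : Type*} {n : ℕ} (k : 𝒳 → 𝒳 → ℝ) (ρ : ℝ) (l : Fin n)
    (x : Fin n → 𝒳) (z : 𝒳) : ℝ :=
  ∑ i, (ridgeMatrix k ρ x)⁻¹ i l * k (x i) z

/-- The part of `ridgeWeight` that is removed by averaging over orbits. -/
noncomputable def ridgeWeightPerp {G 𝒳 : Type*} [MeasurableSpace G] [SMul G 𝒳] (lam : Measure G)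
    {n : ℕ} (k : 𝒳 → 𝒳 → ℝ) (ρ : ℝ) (l : Fin n) (x : Fin n → 𝒳) (z : 𝒳) : ℝ :=
  ridgeWeight k ρ l x z - orbitAverage lam (ridgeWeight k ρ l x) z

section Weights

lemma abs_sub_orbitAverage_le {𝒳 G : Type*} [SMul G 𝒳] [MeasurableSpace G]
    {lam : Measure G} [IsProbabilityMeasure lam] {φ : 𝒳 → ℝ} {C : ℝ} (hC : ∀ x, |φ x| ≤ C) (x : 𝒳) :
    |φ x - orbitAverage lam φ x| ≤ 2 * C := by
  have h1 := hC x
  have h2 := abs_orbitAverage_le (lam := lam) hC x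
  have h3 := abs_sub (φ x) (orbitAverage lam φ x)
  linarith

lemma measurable_ridgeWeight {𝒳 : Type*} [MeasurableSpace 𝒳] {k : 𝒳 → 𝒳 → ℝ}
    (hk : Measurable (fun p : 𝒳 × 𝒳 => k p.1 p.2)) {n : ℕ} (ρ : ℝ) (l : Fin n) :
    Measurable fun p : (Fin n → 𝒳) × 𝒳 => ridgeWeight k ρ l p.1 p.2 := by
  refine Finset.measurable_fun_sum _ fun i _ => ?_
  refine ((measurable_ridgeMatrix_inv_apply hk ρ i l).comp measurable_fst).mul ?_
  exact hk.comp (f := fun p : (Fin n → 𝒳) × 𝒳 => (p.1 i, p.2))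
    (((measurable_pi_apply i).comp measurable_fst).prodMk measurable_snd)

lemma abs_ridgeWeight_le {𝒳 H : Type*} [NormedAddCommGroup H] [InnerProductSpace ℝ H]
    [CompleteSpace H] [RKHS ℝ H 𝒳 ℝ] {M ρ : ℝ} (hρ : 0 < ρ)
    (hM : ∀ x : 𝒳, rkhsKernel H x x ≤ M) {n : ℕ} (l : Fin n) (x : Fin n → 𝒳) (z : 𝒳) :
    |ridgeWeight (rkhsKernel H) ρ l x z| ≤ n * (1 / ρ * M) := by
  refine (Finset.abs_sum_le_sum_abs _ _).trans ?_
  calc ∑ i, |(ridgeMatrix (rkhsKernel H) ρ x)⁻¹ i l * rkhsKernel H (x i) z|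
      ≤ ∑ _i : Fin n, 1 / ρ * M := Finset.sum_le_sum fun i _ => by
        rw [abs_mul]
        exact mul_le_mul (abs_inv_apply_le_of_coercive hρ (ridgeMatrix_coercive ρ x) i l)
          (abs_rkhsKernel_le hM _ _) (abs_nonneg _) (by positivity)
    _ = n * (1 / ρ * M) := by simp

variable {𝒳 : Type*} [MeasurableSpace 𝒳] {G : Type*} [Group G] [MeasurableSpace G]
  [MulAction G 𝒳] [MeasurableSMul₂ G 𝒳] {lam : Measure G} [IsProbabilityMeasure lam]

lemma measurable_kernelPerp {k : 𝒳 → 𝒳 → ℝ} (hk : Measurable (fun p : 𝒳 × 𝒳 => k p.1 p.2)) :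
    Measurable fun p : 𝒳 × 𝒳 => kernelPerp lam k p.1 p.2 :=
  hk.sub (measurable_orbitAverage_param hk)

lemma measurable_ridgeWeightPerp {k : 𝒳 → 𝒳 → ℝ}
    (hk : Measurable (fun p : 𝒳 × 𝒳 => k p.1 p.2)) {n : ℕ} (ρ : ℝ) (l : Fin n) :
    Measurable fun p : (Fin n → 𝒳) × 𝒳 => ridgeWeightPerp lam k ρ l p.1 p.2 :=
  (measurable_ridgeWeight hk ρ l).sub
    (measurable_orbitAverage_param (measurable_ridgeWeight hk ρ l))

/-- Averaging acts on `z` alone, so the inverse matrix passes through it as a constant. -/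
lemma ridgeWeightPerp_eq {k : 𝒳 → 𝒳 → ℝ} {M : ℝ}
    (hk : Measurable (fun p : 𝒳 × 𝒳 => k p.1 p.2)) (hM : ∀ x y, |k x y| ≤ M) {n : ℕ} (ρ : ℝ)
    (l : Fin n) (x : Fin n → 𝒳) (z : 𝒳) :
    ridgeWeightPerp lam k ρ l x z
      = ∑ i, (ridgeMatrix k ρ x)⁻¹ i l * kernelPerp lam k (x i) z := by
  have h := orbitAverage_sum_mul (lam := lam) (φ := fun i => k (x i)) (C := M)
    (fun i => hk.comp (measurable_const.prodMk measurable_id)) (fun i => hM (x i))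
    (fun i => (ridgeMatrix k ρ x)⁻¹ i l) z
  simp only [ridgeWeightPerp, kernelPerp, mul_sub, Finset.sum_sub_distrib, ← h]
  rfl

variable {H : Type*} [NormedAddCommGroup H] [InnerProductSpace ℝ H] [CompleteSpace H]
  [RKHS ℝ H 𝒳 ℝ]

lemma sum_sq_kernelPerp_le {M ρ : ℝ} (hρ : 0 < ρ) (hM0 : 0 ≤ M)
    (hk : Measurable (fun p : 𝒳 × 𝒳 => rkhsKernel H p.1 p.2))
    (hM : ∀ x : 𝒳, rkhsKernel H x x ≤ M) {n : ℕ} (x : Fin n → 𝒳) (z : 𝒳) :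
    ∑ i, kernelPerp lam (rkhsKernel H) (x i) z ^ 2
      ≤ (n * M + ρ) ^ 2 * ∑ l, ridgeWeightPerp lam (rkhsKernel H) ρ l x z
        * ridgeWeightPerp lam (rkhsKernel H) ρ l x z := by
  have h := sq_le_inv_mulVec_of_coercive hρ (ridgeMatrix_coercive (H := H) ρ x) hM0
    (K := Matrix.of fun i j => rkhsKernel H (x i) (x j)) (fun i j => abs_rkhsKernel_le hM _ _) rfl
    (fun i => kernelPerp lam (rkhsKernel H) (x i) z)
  have e : ∀ l, ((ridgeMatrix (rkhsKernel H) ρ x)⁻¹ *ᵥ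
      fun i => kernelPerp lam (rkhsKernel H) (x i) z) l
        = ridgeWeightPerp lam (rkhsKernel H) ρ l x z := fun l => by
    rw [ridgeWeightPerp_eq hk (abs_rkhsKernel_le hM)]
    simp only [Matrix.mulVec, dotProduct]
    refine Finset.sum_congr rfl fun i _ => ?_
    -- The weight sums over the first index of the inverse, `mulVec` over the second; symmetry
    -- reconciles them.
    have h1 : (ridgeMatrix (rkhsKernel H) ρ x)⁻¹ i l = (ridgeMatrix (rkhsKernel H) ρ x)⁻¹ l i :=
      congrFun (congrFun (ridgeMatrix_inv_transpose (H := H) ρ x) l) i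
    rw [h1]
  simp only [dotProduct, e] at h
  simpa only [pow_two (kernelPerp _ _ _ _)] using h

variable {μ : Measure 𝒳} [IsProbabilityMeasure μ]

lemma sum_integral_kernelPerp_sq_le {M ρ : ℝ} (hρ : 0 < ρ) (hM0 : 0 ≤ M)
    (hk : Measurable (fun p : 𝒳 × 𝒳 => rkhsKernel H p.1 p.2))
    (hM : ∀ x : 𝒳, rkhsKernel H x x ≤ M) {n : ℕ} (x : Fin n → 𝒳) :
    ∑ i, ∫ z, kernelPerp lam (rkhsKernel H) (x i) z ^ 2 ∂μ
      ≤ (n * M + ρ) ^ 2 * ∑ l, weightGram μ (ridgeWeightPerp lam (rkhsKernel H) ρ) l l x := by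
  have hi : ∀ i, Integrable (fun z => kernelPerp lam (rkhsKernel H) (x i) z ^ 2) μ := fun i =>
    (memLp_two_of_abs_le ((measurable_kernelPerp hk).comp
      (measurable_const.prodMk measurable_id))
      (abs_sub_orbitAverage_le (abs_rkhsKernel_le hM (x i)))).integrable_sq
  have hw : ∀ l, Integrable (fun z => ridgeWeightPerp lam (rkhsKernel H) ρ l x z
      * ridgeWeightPerp lam (rkhsKernel H) ρ l x z) μ := fun l =>
    integrable_weight_mul (measurable_ridgeWeightPerp hk ρ)
      (fun l x => abs_sub_orbitAverage_le (abs_ridgeWeight_le hρ hM l x)) l l x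
  simp only [weightGram]
  rw [← integral_finsetSum _ fun i _ => hi i, ← integral_finsetSum _ fun l _ => hw l,
    ← integral_const_mul]
  exact integral_mono (integrable_finsetSum _ fun i _ => hi i)
    ((integrable_finsetSum _ fun l _ => hw l).const_mul _)
    fun z => sum_sq_kernelPerp_le hρ hM0 hk hM x z

/-- Every `X i` has law `μ`, so each of the `n` summands has expectation `‖k^⊥‖²`. The resulting
factor `n` is absorbed by `(n M + ρ)² / n = (√n M + ρ / √n)²`. -/
lemma sqNormL2_kernelPerp_div_le {M ρ : ℝ} (hρ : 0 < ρ) (hM0 : 0 ≤ M)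
    (hk : Measurable (fun p : 𝒳 × 𝒳 => rkhsKernel H p.1 p.2))
    (hM : ∀ x : 𝒳, rkhsKernel H x x ≤ M) {Ω : Type*} [MeasurableSpace Ω] {P : Measure Ω}
    [IsProbabilityMeasure P] {n : ℕ} (hn : 0 < n) {X : Fin n → Ω → 𝒳}
    (hX : ∀ i, Measurable (X i)) (hXμ : ∀ i, P.map (X i) = μ) :
    sqNormL2 (μ.prod μ) (fun p => kernelPerp lam (rkhsKernel H) p.1 p.2)
        / (√n * M + ρ / √n) ^ 2
      ≤ ∑ l, ∫ ω, weightGram μ (ridgeWeightPerp lam (rkhsKernel H) ρ) l l (fun i => X i ω) ∂P := by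
  have hZ : Measurable fun ω i => X i ω := measurable_pi_lambda _ hX
  have hsq : Integrable (fun p : 𝒳 × 𝒳 => kernelPerp lam (rkhsKernel H) p.1 p.2 ^ 2) (μ.prod μ) :=
    (memLp_two_of_abs_le (measurable_kernelPerp hk)
      fun p => abs_sub_orbitAverage_le (abs_rkhsKernel_le hM p.1) p.2).integrable_sq
  have hψ : Integrable (fun x => ∫ z, kernelPerp lam (rkhsKernel H) x z ^ 2 ∂μ) μ :=
    hsq.integral_prod_left
  have hS : sqNormL2 (μ.prod μ) (fun p => kernelPerp lam (rkhsKernel H) p.1 p.2)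
      = ∫ x, ∫ z, kernelPerp lam (rkhsKernel H) x z ^ 2 ∂μ ∂μ := integral_prod _ hsq
  have hψX : ∀ i, Integrable
      (fun ω => ∫ z, kernelPerp lam (rkhsKernel H) (X i ω) z ^ 2 ∂μ) P := fun i => by
    rw [← hXμ i] at hψ
    have := hψ.comp_measurable (hX i)
    rwa [hXμ i] at this
  have hψe : ∀ i, ∫ ω, ∫ z, kernelPerp lam (rkhsKernel H) (X i ω) z ^ 2 ∂μ ∂P
      = sqNormL2 (μ.prod μ) (fun p => kernelPerp lam (rkhsKernel H) p.1 p.2) := fun i => by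
    have h := integral_map (hX i).aemeasurable (μ := P)
      (f := fun x => ∫ z, kernelPerp lam (rkhsKernel H) x z ^ 2 ∂μ)
      (by rw [hXμ i]; exact hψ.aestronglyMeasurable)
    rw [hXμ i] at h
    rw [hS, h]
  have hg : ∀ l, Integrable (fun ω =>
      weightGram μ (ridgeWeightPerp lam (rkhsKernel H) ρ) l l (fun i => X i ω)) P := fun l =>
    integrable_of_abs_le
      ((measurable_weightGram (measurable_ridgeWeightPerp hk ρ) l l).comp hZ).aestronglyMeasurable
      fun ω => abs_weightGram_le
        (fun l x => abs_sub_orbitAverage_le (abs_ridgeWeight_le hρ hM l x)) l l _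
  have hmono : ∫ ω, ∑ i, ∫ z, kernelPerp lam (rkhsKernel H) (X i ω) z ^ 2 ∂μ ∂P
      ≤ ∫ ω, (n * M + ρ) ^ 2 * ∑ l,
        weightGram μ (ridgeWeightPerp lam (rkhsKernel H) ρ) l l (fun i => X i ω) ∂P :=
    integral_mono (integrable_finsetSum _ fun i _ => hψX i)
      ((integrable_finsetSum _ fun l _ => hg l).const_mul _)
      fun ω => sum_integral_kernelPerp_sq_le hρ hM0 hk hM _
  rw [integral_finsetSum _ fun i _ => hψX i, integral_const_mul,
    integral_finsetSum _ fun l _ => hg l] at hmono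
  simp only [hψe, Finset.sum_const, Finset.card_univ, Fintype.card_fin, nsmul_eq_mul] at hmono
  have hn' : (0 : ℝ) < n := Nat.cast_pos.2 hn
  have hs : √(n : ℝ) ^ 2 = n := Real.sq_sqrt hn'.le
  have hs0 : 0 < √(n : ℝ) := Real.sqrt_pos.2 hn'
  have hden : (√(n : ℝ) * M + ρ / √n) ^ 2 = (n * M + ρ) ^ 2 / n := by
    rw [← hs, Real.sqrt_sq hs0.le]
    field_simp
  rw [hden, div_div_eq_mul_div, div_le_iff₀ (by positivity)]
  linarith

end Weights

end

/-! ### The excess risk bound -/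

theorem mainTheorem5
    -- the input space and the group acting on it
    {𝒳 : Type*} [TopologicalSpace 𝒳] [PolishSpace 𝒳] [MeasurableSpace 𝒳] [BorelSpace 𝒳]
    {G : Type*} [Group G] [TopologicalSpace G] [IsTopologicalGroup G] [CompactSpace G]
    [T2Space G] [SecondCountableTopology G] [MeasurableSpace G] [BorelSpace G]
    [MulAction G 𝒳] [MeasurableSMul₂ G 𝒳]
    -- the normalised Haar measure
    (lam : Measure G) [lam.IsHaarMeasure] [IsProbabilityMeasure lam]
    -- the invariant input distribution, of full support
    (μ : Measure 𝒳) [IsProbabilityMeasure μ]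
    (hμ_inv : ∀ g : G, μ.map (fun x => g • x) = μ)
    (hμ_supp : μ.support = Set.univ)
    -- the reproducing kernel Hilbert space, with a bounded measurable kernel
    {H : Type*} [NormedAddCommGroup H] [InnerProductSpace ℝ H] [CompleteSpace H]
    [RKHS ℝ H 𝒳 ℝ]
    (hk_meas : Measurable (fun p : 𝒳 × 𝒳 => rkhsKernel H p.1 p.2))
    (hk_cont : ∀ x : 𝒳, Continuous (fun y => rkhsKernel H y x))
    (M : ℝ) (hM : IsLUB (Set.range (fun x : 𝒳 => rkhsKernel H x x)) M)
    -- the invariant target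
    (fstar : 𝒳 → ℝ) (hfstar : MemLp fstar 2 μ)
    (hfstar_inv : ∀ g : G, ∀ᵐ x ∂μ, fstar (g • x) = fstar x)
    (σ : ℝ)
    -- the training sample
    {Ω : Type*} [MeasurableSpace Ω] (P : Measure Ω) [IsProbabilityMeasure P]
    (n : ℕ) (hn : 0 < n)
    (X : Fin n → Ω → 𝒳) (Y ξ : Fin n → Ω → ℝ)
    (hX : ∀ i, Measurable (X i)) (hY : ∀ i, Measurable (Y i))
    (h_indep : iIndepFun (fun i ω => (X i ω, Y i ω)) P)
    (h_ident : ∀ i j, IdentDistrib (fun ω => (X i ω, Y i ω)) (fun ω => (X j ω, Y j ω)) P P)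
    (hX_law : ∀ i, P.map (X i) = μ)
    (hY_eq : ∀ i, ∀ᵐ ω ∂P, Y i ω = fstar (X i ω) + ξ i ω)
    (hξ : ∀ i, MemLp (ξ i) 2 P)
    (hξ_mean : ∀ i,
      P[ξ i | MeasurableSpace.comap (fun ω (l : Fin n) => X l ω) MeasurableSpace.pi]
        =ᵐ[P] fun _ => 0)
    (hξ_cov : ∀ i j,
      P[fun ω => ξ i ω * ξ j ω |
          MeasurableSpace.comap (fun ω (l : Fin n) => X l ω) MeasurableSpace.pi]
        =ᵐ[P] fun _ => if i = j then σ ^ 2 else 0)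
    -- the test pair, on a probability space of its own
    {Ω' : Type*} [MeasurableSpace Ω'] (P' : Measure Ω') [IsProbabilityMeasure P']
    (X' : Ω' → 𝒳) (Y' ξ' : Ω' → ℝ) (hX' : Measurable X')
    (hX'_law : P'.map X' = μ)
    (hY'_eq : ∀ᵐ ω ∂P', Y' ω = fstar (X' ω) + ξ' ω)
    (hξ' : MemLp ξ' 2 P')
    (hξ'_mean : P'[ξ' | MeasurableSpace.comap X' inferInstance] =ᵐ[P'] fun _ => 0)
    (hξ'_var : ∫ ω, ξ' ω ^ 2 ∂P' = σ ^ 2)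
    -- the solutions of the ridge regression problem with noisy and with noiseless outputs
    (ρ : ℝ) (hρ : 0 < ρ)
    (f Λfstar : Ω → H)
    (hf : ∀ᵐ ω ∂P, IsKRRSolution ρ (fun i => X i ω) (fun i => Y i ω) (f ω))
    (hΛ : ∀ᵐ ω ∂P, IsKRRSolution ρ (fun i => X i ω) (fun i => fstar (X i ω)) (Λfstar ω))
    -- the competing predictor, which may depend on the training sample
    (f' : Ω → 𝒳 → ℝ) (hf' : ∀ᵐ ω ∂P, MemLp (f' ω) 2 μ)
    (hf'_meas : AEMeasurable (fun ω => risk P' X' Y' (f' ω)) P)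
    (hf'_risk : ∀ᵐ ω ∂P, risk P' X' Y' (f' ω) ≤ risk P' X' Y' (orbitAverage lam (f ω))) :
    Integrable (fun ω => risk P' X' Y' (f ω)) P ∧
    Integrable (fun ω => risk P' X' Y' (f' ω)) P ∧
    Integrable (fun ω => sqNormL2 μ (fun x => Λfstar ω x - orbitAverage lam (Λfstar ω) x)) P ∧
    (∫ ω, sqNormL2 μ (fun x => Λfstar ω x - orbitAverage lam (Λfstar ω) x) ∂P)
        + σ ^ 2 *
          (sqNormL2 (μ.prod μ) (fun p => kernelPerp lam (rkhsKernel H) p.1 p.2)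
            / (√n * M + ρ / √n) ^ 2)
      ≤ ∫ ω, (risk P' X' Y' (f ω) - risk P' X' Y' (f' ω)) ∂P := by
  have hMle : ∀ x : 𝒳, rkhsKernel H x x ≤ M := fun x => hM.1 ⟨x, rfl⟩
  have hM0 : 0 ≤ M := by
    obtain ⟨x⟩ : Nonempty 𝒳 := nonempty_of_isProbabilityMeasure μ
    exact (rkhsKernel_self_nonneg x).trans (hMle x)
  set Z : Ω → Fin n → 𝒳 := fun ω l => X l ω with hZdef
  have hZ : Measurable Z := measurable_pi_lambda _ hX
  set a : Fin n → (Fin n → 𝒳) → 𝒳 → ℝ := ridgeWeight (rkhsKernel H) ρ with hadef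
  set b : Fin n → (Fin n → 𝒳) → 𝒳 → ℝ := ridgeWeightPerp lam (rkhsKernel H) ρ with hbdef
  have ha : ∀ l, Measurable fun p : (Fin n → 𝒳) × 𝒳 => a l p.1 p.2 :=
    measurable_ridgeWeight hk_meas ρ
  have hb : ∀ l, Measurable fun p : (Fin n → 𝒳) × 𝒳 => b l p.1 p.2 :=
    measurable_ridgeWeightPerp hk_meas ρ
  have haC : ∀ l w z, |a l w z| ≤ n * (1 / ρ * M) := abs_ridgeWeight_le hρ hMle
  have hbC : ∀ l w z, |b l w z| ≤ 2 * (n * (1 / ρ * M)) := fun l w =>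
    abs_sub_orbitAverage_le (haC l w)
  have hu : ∀ l, MemLp (fun ω => fstar (X l ω)) 2 P := fun l => by
    rw [← hX_law l] at hfstar
    exact hfstar.comp_of_map (hX l).aemeasurable
  have hum : ∀ l, AEStronglyMeasurable[MeasurableSpace.comap Z MeasurableSpace.pi]
      (fun ω => fstar (X l ω)) P := fun l => by
    obtain ⟨v, hv, hve⟩ := hfstar.aestronglyMeasurable
    refine ⟨fun ω => v (Z ω l), ?_,
      ae_of_ae_map (p := fun x => fstar x = v x) (hX l).aemeasurable (by rwa [hX_law l])⟩
    exact hv.comp_measurable ((measurable_pi_apply l).comp (comap_measurable Z))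
  have huξ : ∀ l, MemLp (fun ω => fstar (X l ω) + ξ l ω) 2 P := fun l => (hu l).add (hξ l)
  have hperp : ∀ (y : Fin n → ℝ) (w : Fin n → 𝒳),
      (fun z => ∑ l, y l * a l w z - orbitAverage lam (fun z => ∑ l, y l * a l w z) z)
        = fun z => ∑ l, y l * b l w z := fun y w => by
    funext z
    rw [orbitAverage_sum_mul (fun i => measurable_section ha i w) (fun i => haC i w),
      ← Finset.sum_sub_distrib]
    exact Finset.sum_congr rfl fun l _ => (mul_sub _ _ _).symm
  -- The minimiser is not assumed measurable in `ω`; measurability of its risk comes from this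
  -- explicit smoother.
  have hf_eq : ∀ᵐ ω ∂P, (f ω : 𝒳 → ℝ)
      = fun z => ∑ l, (fstar (X l ω) + ξ l ω) * a l (Z ω) z := by
    filter_upwards [hf, ae_all_iff.2 hY_eq] with ω h1 h2
    funext z
    rw [h1.apply_eq hρ]
    exact Finset.sum_congr rfl fun l _ => by rw [h2 l]; rfl
  have hΛ_eq : ∀ᵐ ω ∂P, (Λfstar ω : 𝒳 → ℝ) = fun z => ∑ l, fstar (X l ω) * a l (Z ω) z := by
    filter_upwards [hΛ] with ω h1
    funext z
    exact h1.apply_eq hρ z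
  have hrisk : ∀ h : 𝒳 → ℝ, MemLp h 2 μ →
      risk P' X' Y' h = ∫ x, (h x - fstar x) ^ 2 ∂μ + σ ^ 2 := fun h hh =>
    risk_eq_integral_sub_sq_add hX' hX'_law hY'_eq hξ' hξ'_mean hξ'_var hfstar hh
  have hsm : ∀ (y : Fin n → ℝ) (w : Fin n → 𝒳), Measurable fun z => ∑ l, y l * a l w z :=
    measurable_sum_mul_weight ha
  have hsb := abs_sum_mul_weight_le haC
  have hf_int : Integrable (fun ω => risk P' X' Y' (f ω)) P := by
    refine ((integrable_smoother_sub_sq hZ ha haC huξ hfstar).add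
      (integrable_const (σ ^ 2))).congr ?_
    filter_upwards [hf_eq] with ω h1
    rw [h1, hrisk _ (memLp_two_of_abs_le (hsm _ _) (hsb _ _))]
    rfl
  -- The competitor does at least as well as the averaged predictor, so Pythagoras bounds the gap
  -- below by the non-invariant part of `f`.
  have hgap : ∀ᵐ ω ∂P, sqNormL2 μ (fun z => ∑ l, (fstar (X l ω) + ξ l ω) * b l (Z ω) z)
      ≤ risk P' X' Y' (f ω) - risk P' X' Y' (f' ω) := by
    filter_upwards [hf_eq, hf'_risk] with ω h1 h2
    rw [h1] at h2 ⊢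
    have hm := hsm (fun l => fstar (X l ω) + ξ l ω) (Z ω)
    have hc := hsb (fun l => fstar (X l ω) + ξ l ω) (Z ω)
    rw [hrisk _ (memLp_two_of_abs_le (measurable_orbitAverage hm) (abs_orbitAverage_le hc))] at h2
    rw [hrisk _ (memLp_two_of_abs_le hm hc),
      integral_sub_sq_eq_orbitAverage_add (lam := lam) hμ_inv hm hc hfstar hfstar_inv, hperp]
    linarith
  have hnn : ∀ (h : 𝒳 → ℝ), 0 ≤ risk P' X' Y' h := fun h =>
    integral_nonneg fun ω => sq_nonneg _
  have hsqnn : ∀ h : 𝒳 → ℝ, 0 ≤ sqNormL2 μ h := fun h => integral_nonneg fun ω => sq_nonneg _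
  -- The gap dominates a squared norm, so `0 ≤ R[f'] ≤ R[f]` almost surely.
  have hf'_int : Integrable (fun ω => risk P' X' Y' (f' ω)) P := by
    refine hf_int.mono' hf'_meas.aestronglyMeasurable ?_
    filter_upwards [hgap] with ω h1
    rw [Real.norm_eq_abs, abs_of_nonneg (hnn _)]
    linarith [hsqnn (fun z => ∑ l, (fstar (X l ω) + ξ l ω) * b l (Z ω) z)]
  have hΛ_sq : (fun ω => sqNormL2 μ (fun z => ∑ l, fstar (X l ω) * b l (Z ω) z))
      =ᵐ[P] fun ω => sqNormL2 μ (fun x => Λfstar ω x - orbitAverage lam (Λfstar ω) x) := by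
    filter_upwards [hΛ_eq] with ω h1
    rw [h1, hperp]
  refine ⟨hf_int, hf'_int, (integrable_sqNormL2_smoother hZ hb hbC hu).congr hΛ_sq, ?_⟩
  rw [← integral_congr_ae hΛ_sq]
  calc _ ≤ ∫ ω, sqNormL2 μ (fun z => ∑ l, fstar (X l ω) * b l (Z ω) z) ∂P
        + σ ^ 2 * ∑ l, ∫ ω, weightGram μ b l l (Z ω) ∂P := by
        gcongr
        exact sqNormL2_kernelPerp_div_le hρ hM0 hk_meas hMle hn hX hX_law
    _ = ∫ ω, sqNormL2 μ (fun z => ∑ l, (fstar (X l ω) + ξ l ω) * b l (Z ω) z) ∂P :=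
        (integral_sqNormL2_smoother_add_noise hZ hb hbC hu hum hξ hξ_mean hξ_cov).symm
    _ ≤ _ := integral_mono_ae (integrable_sqNormL2_smoother hZ hb hbC huξ)
        (hf_int.sub hf'_int) hgap
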